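/- For integers $k_1,\dots,k_{r-1}\ge 1$ and $k_r\ge 2$ let $$\zeta(k_1,\dots,k_r)=\sum_{0<m_1<\cdots<m_r}\frac{1}{m_1^{k_1}\cdots m_r^{k_r}},$$ and write $(\{1\}^a,n)$ for the index $(1,\dots,1,n)$ with $a$ ones. For $n\ge 1$ let $\mathrm{Li}_n$ be the polylogarithm $\mathrm{Li}_n(z)=\sum_{j\ge1} z^j/j^n$ ($|z|<1$), continued analytically to the real half-line $z<1$; that is, $\mathrm{Li}_0(z)=z/(1-z)$ and $\mathrm{Li}_{n}(z)=\int_0^z \mathrm{Li}_{n-1}(w)\,\frac{dw}{w}$. For $n\ge1$ and $\Re s>0$ let $$\eta(n;s)=\frac{1}{\Gamma(s)}\int_0^\infty t^{s-1}\,\frac{\mathrm{Li}_n(1-e^t)}{1-e^t}\,dt$$ be the Kaneko–Tsumura function. Then for every integer $k\ge 0$ the integrals $\eta(r+1;m+1)$ with $r,m\ge0$, $r+m=k$, and the series $\zeta(\{1\}^a,b+2)$ with $a,b\ge0$, $a+b=k$, converge absolutely, and $$\sum_{\substack{r+m=k\\ r,m\ge0}}(-1)^m\,\eta(r+1;m+1)=\sum_{\substack{a+b=k\\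 a,b\ge0}}(-1)^a\,\zeta(\{1\}^a,b+2)=\begin{cases}2\left(1-\dfrac{1}{2^{2c+1}}\right)\zeta(2c+2)&\text{if }k=2c,\\[1ex]0&\text{if }k=2c+1,\end{cases}$$ where $c\ge0$ is an integer. -/

import Mathlib

noncomputable section

/-- The general term `1 / (m₁^{k₁} ⋯ m_r^{k_r})` of the series
`ζ(k₁, …, k_r) = ∑_{0 < m₁ < ⋯ < m_r} 1 / (m₁^{k₁} ⋯ m_r^{k_r})`. -/
def mzvTerm {r : ℕ} (k : Fin r → ℕ) (m : {m : Fin r → ℕ // (∀ i, 0 < m i) ∧ StrictMono m}) : ℝ :=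
  1 / ∏ i, (m.1 i : ℝ) ^ k i

/-- The multiple zeta value `ζ(k₁, …, k_r)`, for indices with `kᵢ ≥ 1` and `k_r ≥ 2`
(the largest summation variable carries the last exponent). -/
def multiZeta {r : ℕ} (k : Fin r → ℕ) : ℝ :=
  ∑' m, mzvTerm k m

/-- The index `({1}^a, n) = (1, …, 1, n)` with `a` ones. -/
def onesThen (a n : ℕ) : Fin (a + 1) → ℕ :=
  Fin.snoc (α := fun _ => ℕ) (fun _ : Fin a => 1) n

/-- The polylogarithm `Li_k` on the real half-line `z < 1`, as the iterated integral
`Li_0(z) = z / (1 - z)`, `Li_{k+1}(z) = ∫_0^z Li_k(w) / w dw`. It is the (real-)analytic continuation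
of `∑_{n ≥ 1} z^n / n^k` from `|z| < 1`; in particular `Li_1(z) = -log (1 - z)`. The continuation is
needed since `Li_k` is evaluated at `1 - e^t` for all `t > 0`. -/
def polyLi : ℕ → ℝ → ℝ
  | 0, z => z / (1 - z)
  | k + 1, z => ∫ w in (0 : ℝ)..z, polyLi k w / w

/-- The integrand `t^{s-1} Li_k(1 - e^t) / (1 - e^t)` of the Kaneko–Tsumura function. -/
def etaIntegrand (k : ℕ) (s : ℂ) (t : ℝ) : ℂ :=
  (t : ℂ) ^ (s - 1) * ((polyLi k (1 - Real.exp t) / (1 - Real.exp t) : ℝ) : ℂ)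

/-- The Kaneko–Tsumura function
`η(k; s) = 1 / Γ(s) * ∫_0^∞ t^{s-1} Li_k(1 - e^t) / (1 - e^t) dt`, for `k ≥ 1` and `Re s > 0`. -/
def kanekoTsumuraEta (k : ℕ) (s : ℂ) : ℂ :=
  1 / Complex.Gamma s * ∫ t in Set.Ioi (0 : ℝ), etaIntegrand k s t

end

/-! Both families are moments `1/(r! m!) ∫∫ s^r t^m W(s,t)` of symmetric kernels supported on the
positive quadrant: `W = 1/(e^s + e^t - 1)` gives `η(r+1; m+1)` (`kanekoTsumuraEta_eq_kernelMoment`),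
and the indicator of `e^{-s} + e^{-t} > 1` gives `ζ({1}^a, b+2)` with `r = b`, `m = a`
(`multiZeta_onesThen_eq`).

By the binomial theorem the alternating sum of the moments of degree `k` is `∫∫ (s-t)^k/k! W`, which
depends only on the integrals of `W` along the lines `s - t = v`. For both kernels these equal
`log(1 + e^{-|v|})` when `v ≠ 0`, so the two sums agree (`sum_kernelMoment_eq`).

The common value is `∫ v^k/k! log(1 + e^{-|v|}) dv`. It vanishes for odd `k` by parity. For even `k`
it is twice the half-line integral, which `integral_pow_mul_log_one_add_exp_neg` evaluates as `(1 -
2^{-(k+1)}) ζ(k+2)`. -/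

open MeasureTheory Set

/-! ### Alternating moments of symmetric kernels -/

/-- A symmetric kernel on the plane, rapidly decaying in a product sense, whose integral along the
line `s - t = v` is `log (1 + e^{-v})`. -/
structure IsDiagKernel (W : ℝ × ℝ → ℝ) : Prop where
  meas : Measurable W
  symm : ∀ s t, W (s, t) = W (t, s)
  dom : ∃ g : ℝ → ℝ, (∀ n : ℕ, Integrable fun s => s ^ n * g s) ∧ ∀ s t, |W (s, t)| ≤ g s * g t
  diag : ∀ v, 0 < v → ∫ t, W (t + v, t) = Real.log (1 + Real.exp (-v))

/-- The moment `1 / (r! m!) ∫∫ s^r t^m W(s, t)`. -/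
noncomputable def kernelMoment (W : ℝ × ℝ → ℝ) (r m : ℕ) : ℝ :=
  ∫ p : ℝ × ℝ, p.1 ^ r / r.factorial * (p.2 ^ m / m.factorial) * W p

namespace IsDiagKernel

variable {W : ℝ × ℝ → ℝ}

/-- The product bound separates the variables, so the moment is dominated by a product of two
integrable functions of one variable. -/
theorem integrable_moment (h : IsDiagKernel W) (r m : ℕ) :
    Integrable fun p : ℝ × ℝ => p.1 ^ r / r.factorial * (p.2 ^ m / m.factorial) * W p := by
  obtain ⟨g, hg, hW⟩ := h.dom
  have hi := ((hg r).mul_prod (hg m)).norm.const_mul (1 / (r.factorial * m.factorial : ℝ))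
  refine hi.mono' ?_ (Filter.Eventually.of_forall ?_)
  · have := h.meas
    exact Measurable.aestronglyMeasurable (by fun_prop)
  · rintro ⟨s, t⟩
    have h1 : |W (s, t)| ≤ |g s * g t| := (hW s t).trans (le_abs_self _)
    have h2 : ‖s ^ r / r.factorial * (t ^ m / m.factorial) * W (s, t)‖ =
        1 / (r.factorial * m.factorial : ℝ) * (|s ^ r| * |t ^ m|) * |W (s, t)| := by
      simp only [Real.norm_eq_abs, abs_mul, abs_div, Nat.abs_cast]
      field_simp
    have h3 : 1 / (r.factorial * m.factorial : ℝ) * ‖s ^ r * g s * (t ^ m * g t)‖ =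
        1 / (r.factorial * m.factorial : ℝ) * (|s ^ r| * |t ^ m|) * |g s * g t| := by
      simp only [Real.norm_eq_abs, abs_mul]
      ring
    simp only [h2, h3]
    gcongr

theorem sum_moment_integrand (W : ℝ × ℝ → ℝ) (k : ℕ) (p : ℝ × ℝ) :
    ∑ q ∈ Finset.HasAntidiagonal.antidiagonal k, (-1 : ℝ) ^ q.2 *
      (p.1 ^ q.1 / q.1.factorial * (p.2 ^ q.2 / q.2.factorial) * W p) =
      (p.1 - p.2) ^ k / k.factorial * W p := by
  have h1 : (p.1 - p.2) ^ k = ∑ q ∈ Finset.HasAntidiagonal.antidiagonal k,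
      (k.choose q.1 : ℝ) * (p.1 ^ q.1 * (-p.2) ^ q.2) := by
    rw [sub_eq_add_neg, (Commute.all p.1 (-p.2)).add_pow']
    simp [nsmul_eq_mul]
  rw [h1, Finset.sum_div, Finset.sum_mul]
  refine Finset.sum_congr rfl fun q hq => ?_
  have hq' := Finset.HasAntidiagonal.mem_antidiagonal.mp hq
  have h2 : (k.choose q.1 : ℝ) * q.1.factorial * q.2.factorial = k.factorial := by
    rw [← hq']
    rw [Nat.choose_symm_add]
    exact_mod_cast Nat.add_choose_mul_factorial_mul_factorial q.1 q.2
  rw [← h2, neg_pow p.2]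
  have : (k.choose q.1 : ℝ) ≠ 0 := by
    rw [← hq']
    exact_mod_cast (Nat.choose_pos (Nat.le_add_right _ _)).ne'
  field_simp

theorem integrable_sub_pow (h : IsDiagKernel W) (k : ℕ) :
    Integrable fun p : ℝ × ℝ => (p.1 - p.2) ^ k / k.factorial * W p := by
  simp_rw [← sum_moment_integrand W k]
  exact integrable_finsetSum _ fun q _ => (h.integrable_moment q.1 q.2).const_mul _

theorem sum_kernelMoment (h : IsDiagKernel W) (k : ℕ) :
    ∑ q ∈ Finset.HasAntidiagonal.antidiagonal k, (-1 : ℝ) ^ q.2 * kernelMoment W q.1 q.2 =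
      ∫ p : ℝ × ℝ, (p.1 - p.2) ^ k / k.factorial * W p := by
  simp_rw [← sum_moment_integrand W k, kernelMoment]
  rw [integral_finsetSum _ fun q _ => (h.integrable_moment q.1 q.2).const_mul _]
  simp_rw [integral_const_mul]

/-- For `v < 0`, translating `t` by `-v` and using symmetry reduces to the line `-v > 0`. -/
theorem diag_of_ne_zero (h : IsDiagKernel W) {v : ℝ} (hv : v ≠ 0) :
    ∫ t, W (t + v, t) = Real.log (1 + Real.exp (-|v|)) := by
  rcases lt_or_gt_of_ne hv with hv | hv
  · rw [abs_of_neg hv, ← h.diag (-v) (by linarith),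
      ← integral_add_right_eq_self (fun t => W (t + v, t)) (-v)]
    refine integral_congr_ae (Filter.Eventually.of_forall fun t => ?_)
    simp only [neg_add_cancel_right]
    exact h.symm _ _
  · rw [abs_of_pos hv, h.diag v hv]

theorem integral_sub_pow (h : IsDiagKernel W) (k : ℕ) :
    Integrable (fun v : ℝ => v ^ k / k.factorial * Real.log (1 + Real.exp (-|v|))) ∧
    ∫ p : ℝ × ℝ, (p.1 - p.2) ^ k / k.factorial * W p =
      ∫ v : ℝ, v ^ k / k.factorial * Real.log (1 + Real.exp (-|v|)) := by
  set f : ℝ × ℝ → ℝ := fun p => (p.1 - p.2) ^ k / k.factorial * W p with hf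
  have hi : Integrable f := h.integrable_sub_pow k
  -- The shear `(v, t) ↦ (t + v, t)` preserves area and turns `s - t` into the first coordinate, so
  -- Fubini applies.
  let e : ℝ × ℝ → ℝ × ℝ := fun z => (z.2 + z.1, z.2)
  have he : MeasurePreserving e (volume.prod volume) (volume.prod volume) :=
    (Measure.measurePreserving_swap).comp (measurePreserving_prod_add_swap volume volume)
  have hi' : Integrable (f ∘ e) (volume.prod volume) := he.integrable_comp_of_integrable hi
  have hae : (fun v : ℝ => ∫ t, (f ∘ e) (v, t)) =ᵐ[volume]
      fun v => v ^ k / k.factorial * Real.log (1 + Real.exp (-|v|)) := by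
    -- The line integral is not prescribed at `v = 0`, which is a null set.
    filter_upwards [compl_mem_ae_iff.mpr (measure_singleton (0 : ℝ))] with v hv
    rw [← h.diag_of_ne_zero hv, ← integral_const_mul]
    simp [hf, e]
  refine ⟨hi'.integral_prod_left.congr hae, ?_⟩
  rw [← integral_congr_ae hae, ← integral_prod _ hi']
  have := integral_map (μ := volume.prod volume) (f := f) he.measurable.aemeasurable
    (by rw [he.map_eq]; exact hi.aestronglyMeasurable)
  rwa [he.map_eq] at this

theorem integral_even_weight (k : ℕ)
    (hi : Integrable fun v : ℝ => v ^ k / k.factorial * Real.log (1 + Real.exp (-|v|))) :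
    ∫ v : ℝ, v ^ k / k.factorial * Real.log (1 + Real.exp (-|v|)) =
      (1 + (-1) ^ k) *
        ∫ v in Ioi (0 : ℝ), v ^ k / k.factorial * Real.log (1 + Real.exp (-v)) := by
  rw [← integral_add_compl (measurableSet_Ioi (a := (0 : ℝ))) hi, compl_Ioi]
  have h1 := integral_comp_neg_Iic (0 : ℝ)
    fun v : ℝ => (-1) ^ k * (v ^ k / k.factorial * Real.log (1 + Real.exp (-|v|)))
  have h2 : ∫ v in Iic (0 : ℝ), v ^ k / k.factorial * Real.log (1 + Real.exp (-|v|)) =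
      (-1) ^ k * ∫ v in Ioi (0 : ℝ), v ^ k / k.factorial * Real.log (1 + Real.exp (-|v|)) := by
    rw [← integral_const_mul]
    rw [neg_zero] at h1
    rw [← h1]
    congr 1 with v
    rw [abs_neg, neg_pow v, mul_div_assoc, ← mul_assoc, ← mul_assoc, ← mul_pow]
    norm_num
  rw [h2, add_mul, one_mul]
  have h3 : ∫ v in Ioi (0 : ℝ), v ^ k / k.factorial * Real.log (1 + Real.exp (-|v|)) =
      ∫ v in Ioi (0 : ℝ), v ^ k / k.factorial * Real.log (1 + Real.exp (-v)) :=
    setIntegral_congr_fun measurableSet_Ioi fun v hv => by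
      simp only [abs_of_pos (mem_Ioi.mp hv)]
  rw [h3]

/-- The alternating sum of the moments of total degree `k` does not depend on the kernel. -/
theorem sum_kernelMoment_eq (h : IsDiagKernel W) (k : ℕ) :
    ∑ q ∈ Finset.HasAntidiagonal.antidiagonal k, (-1 : ℝ) ^ q.2 * kernelMoment W q.1 q.2 =
      (1 + (-1) ^ k) *
        ∫ v in Ioi (0 : ℝ), v ^ k / k.factorial * Real.log (1 + Real.exp (-v)) := by
  rw [h.sum_kernelMoment, (h.integral_sub_pow k).2, integral_even_weight k (h.integral_sub_pow k).1]

end IsDiagKernel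

/-! ### The two kernels -/

/-- The kernel `1 / (e^s + e^t - 1)` on the positive quadrant. -/
noncomputable def expKernel (p : ℝ × ℝ) : ℝ :=
  if 0 < p.1 ∧ 0 < p.2 then 1 / (Real.exp p.1 + Real.exp p.2 - 1) else 0

/-- The indicator function of the region `e^{-s} + e^{-t} > 1` in the positive quadrant. -/
noncomputable def regionKernel (p : ℝ × ℝ) : ℝ :=
  if (0 < p.1 ∧ 0 < p.2) ∧ 1 < Real.exp (-p.1) + Real.exp (-p.2) then 1 else 0

theorem measurableSet_quadrant : MeasurableSet {p : ℝ × ℝ | 0 < p.1 ∧ 0 < p.2} :=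
  (measurableSet_lt measurable_const measurable_fst).inter
    (measurableSet_lt measurable_const measurable_snd)

theorem measurable_expKernel : Measurable expKernel :=
  Measurable.ite measurableSet_quadrant (by fun_prop) measurable_const

theorem measurable_regionKernel : Measurable regionKernel :=
  have h : Measurable fun p : ℝ × ℝ => Real.exp (-p.1) + Real.exp (-p.2) := by fun_prop
  Measurable.ite (measurableSet_quadrant.inter (measurableSet_lt measurable_const h))
    measurable_const measurable_const

/-- Supplies the dominating functions of both kernels; `α` may be negative because the second one
needs an integrable singularity at `0`. -/
theorem integrable_pow_mul_indicator {α b : ℝ} (hα : -1 < α) (hb : 0 < b) (n : ℕ) :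
    Integrable fun s : ℝ => s ^ n * (Ioi (0 : ℝ)).indicator
      (fun s => s ^ α * Real.exp (-b * s)) s := by
  have h := integrableOn_rpow_mul_exp_neg_mul_rpow (s := n + α) (p := 1) (b := b)
    (by have : (0 : ℝ) ≤ n := n.cast_nonneg
        linarith) one_pos hb
  refine ((integrable_indicator_iff measurableSet_Ioi).mpr h).congr
    (Filter.Eventually.of_forall fun s => ?_)
  by_cases hs : s ∈ Ioi (0 : ℝ)
  · simp only [indicator_of_mem hs, Real.rpow_one]
    rw [Real.rpow_add (mem_Ioi.mp hs), Real.rpow_natCast, mul_assoc]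
  · simp only [indicator_of_notMem hs, mul_zero]

theorem integrableOn_pow_mul_exp_neg (n : ℕ) {b : ℝ} (hb : 0 < b) :
    IntegrableOn (fun s : ℝ => s ^ n * Real.exp (-b * s)) (Ioi 0) := by
  have h := integrableOn_rpow_mul_exp_neg_mul_rpow (s := n) (p := 1) (b := b)
    (by have : (0 : ℝ) ≤ n := n.cast_nonneg
        linarith) one_pos hb
  simpa only [Real.rpow_one, Real.rpow_natCast] using h

/-- An antiderivative is `log (1 - e^{-t}/c)`, which vanishes at infinity. -/
theorem integral_Ioi_one_div_mul_exp_sub_one {c : ℝ} (hc : 1 < c) :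
    ∫ t in Ioi (0 : ℝ), 1 / (c * Real.exp t - 1) = -Real.log (1 - 1 / c) := by
  have key : ∀ t : ℝ, 0 ≤ t → 1 < c * Real.exp t := fun t ht =>
    hc.trans_le (le_mul_of_one_le_right (by linarith) (Real.one_le_exp ht))
  have hpos : ∀ t : ℝ, 0 ≤ t → 0 < 1 - Real.exp (-t) / c := fun t ht => by
    have h1 := key t ht
    rw [sub_pos, div_lt_one (by linarith), Real.exp_neg, inv_lt_iff_one_lt_mul₀ (Real.exp_pos t)]
    linarith
  have hd : ∀ t ∈ Ici (0 : ℝ), HasDerivAt (fun t => Real.log (1 - Real.exp (-t) / c))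
      (1 / (c * Real.exp t - 1)) t := fun t ht => by
    have h1 := (((hasDerivAt_neg t).exp.div_const c).const_sub 1).log (hpos t ht).ne'
    convert! h1 using 1
    have h2 := key t ht
    have h3 := hpos t ht
    have h4 : c * Real.exp t - 1 ≠ 0 := by linarith
    have h5 : 1 - Real.exp (-t) / c = (c * Real.exp t - 1) / (c * Real.exp t) := by
      rw [Real.exp_neg]; field_simp
    rw [h5, Real.exp_neg]
    field_simp
  have hlim : Filter.Tendsto (fun t => Real.log (1 - Real.exp (-t) / c)) Filter.atTop (nhds 0) := by
    have h1 : Filter.Tendsto (fun t => 1 - Real.exp (-t) / c) Filter.atTop (nhds (1 - 0 / c)) :=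
      (Real.tendsto_exp_neg_atTop_nhds_zero.div_const c).const_sub 1
    have h2 := h1.log (by simp)
    simpa using h2
  rw [integral_Ioi_of_hasDerivAt_of_nonneg' hd _ hlim]
  · simp
  · intro t ht
    have := key t (le_of_lt ht)
    exact one_div_nonneg.mpr (by linarith)

theorem isDiagKernel_expKernel : IsDiagKernel expKernel where
  meas := measurable_expKernel
  symm s t := by simp only [expKernel, and_comm, add_comm]
  dom := by
    refine ⟨_, integrable_pow_mul_indicator (α := 0) (b := 1 / 2) (by norm_num) (by norm_num),
      fun s t => ?_⟩
    by_cases hst : 0 < s ∧ 0 < t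
    · have h1 : s ∈ Ioi (0 : ℝ) := hst.1
      have h2 : t ∈ Ioi (0 : ℝ) := hst.2
      have h3 : Real.exp s = Real.exp (1 / 2 * s) ^ 2 := by rw [← Real.exp_nat_mul]; ring_nf
      have h4 : Real.exp t = Real.exp (1 / 2 * t) ^ 2 := by rw [← Real.exp_nat_mul]; ring_nf
      have h5 : 1 ≤ Real.exp (1 / 2 * s) := Real.one_le_exp (by linarith [hst.1])
      have h6 : 1 ≤ Real.exp (1 / 2 * t) := Real.one_le_exp (by linarith [hst.2])
      -- With `x = e^{s/2}` and `y = e^{t/2}`, `x² + y² - xy = (x-y)² + xy ≥ 1`. Hence the kernel is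
      -- at most `e^{-s/2} e^{-t/2}`.
      have h7 : Real.exp (1 / 2 * s) * Real.exp (1 / 2 * t) ≤ Real.exp s + Real.exp t - 1 := by
        rw [h3, h4]
        nlinarith [sq_nonneg (Real.exp (1 / 2 * s) - Real.exp (1 / 2 * t))]
      have h8 : 0 < Real.exp (1 / 2 * s) * Real.exp (1 / 2 * t) := by positivity
      simp only [expKernel, if_pos hst, indicator_of_mem h1, indicator_of_mem h2, Real.rpow_zero,
        one_mul, neg_mul, Real.exp_neg]
      rw [abs_of_pos (one_div_pos.mpr (h8.trans_le h7)), ← mul_inv, ← one_div]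
      exact one_div_le_one_div_of_le h8 h7
    · rw [expKernel, if_neg hst, abs_zero]
      exact mul_nonneg (indicator_nonneg (fun x _ => by positivity) _)
        (indicator_nonneg (fun x _ => by positivity) _)
  diag v hv := by
    have h1 : (fun t => expKernel (t + v, t)) =
        (Ioi (0 : ℝ)).indicator fun t => 1 / ((Real.exp v + 1) * Real.exp t - 1) := by
      ext t
      by_cases ht : 0 < t
      · have h2 : t ∈ Ioi (0 : ℝ) := ht
        rw [indicator_of_mem h2, expKernel, if_pos ⟨by simp only; linarith, ht⟩]
        simp only [Real.exp_add]
        ring_nf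
      · have h2 : t ∉ Ioi (0 : ℝ) := ht
        rw [indicator_of_notMem h2, expKernel, if_neg (fun h => ht h.2)]
    rw [h1, integral_indicator measurableSet_Ioi,
      integral_Ioi_one_div_mul_exp_sub_one (by linarith [Real.exp_pos v]), ← Real.log_inv]
    congr 1
    have := Real.exp_pos v
    have h3 : 1 - 1 / (Real.exp v + 1) = Real.exp v / (Real.exp v + 1) := by field_simp; ring
    rw [h3, Real.exp_neg]
    field_simp

/-- This is `s/2 ≤ sinh (s/2)` multiplied by `2 e^{s/2}`. -/
theorem mul_exp_half_le_exp_sub_one {s : ℝ} (hs : 0 ≤ s) :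
    s * Real.exp (s / 2) ≤ Real.exp s - 1 := by
  have h1 := Real.self_le_sinh_iff.mpr (by linarith : 0 ≤ s / 2)
  rw [Real.sinh_eq, Real.exp_neg] at h1
  have h2 : Real.exp s = Real.exp (s / 2) ^ 2 := by rw [← Real.exp_nat_mul]; ring_nf
  have h3 := Real.exp_pos (s / 2)
  rw [h2]
  have h4 : s ≤ Real.exp (s / 2) - (Real.exp (s / 2))⁻¹ := by linarith
  calc s * Real.exp (s / 2) ≤ (Real.exp (s / 2) - (Real.exp (s / 2))⁻¹) * Real.exp (s / 2) := by
        gcongr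
    _ = _ := by field_simp

theorem lt_neg_log_one_sub_iff {s y : ℝ} (hy : y < 1) :
    s < -Real.log (1 - y) ↔ 1 < Real.exp (-s) + y := by
  rw [lt_neg, Real.log_lt_iff_lt_exp (by linarith), sub_lt_iff_lt_add]

theorem isDiagKernel_regionKernel : IsDiagKernel regionKernel where
  meas := measurable_regionKernel
  symm s t := by simp only [regionKernel, and_comm, add_comm]
  dom := by
    refine ⟨_, integrable_pow_mul_indicator (α := -1 / 2) (b := 1 / 4) (by norm_num) (by norm_num),
      fun s t => ?_⟩
    by_cases hst : (0 < s ∧ 0 < t) ∧ 1 < Real.exp (-s) + Real.exp (-t)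
    · obtain ⟨⟨hs, ht⟩, h⟩ := hst
      have h1 : s ∈ Ioi (0 : ℝ) := hs
      have h2 : t ∈ Ioi (0 : ℝ) := ht
      -- The region is `(e^s - 1)(e^t - 1) < 1`, so `s e^{s/2} · t e^{t/2} ≤ 1` there, and the power
      -- `-1/2` of that product dominates the indicator. This is the source of `α = -1/2` and `b =
      -- 1/4`.
      have key : ∀ x : ℝ, 0 < x → x ^ (-1 / 2 : ℝ) * Real.exp (-(1 / 4) * x) =
          (x * Real.exp (x / 2)) ^ (-1 / 2 : ℝ) := fun x hx => by
        rw [Real.mul_rpow hx.le (Real.exp_pos _).le, ← Real.exp_mul]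
        ring_nf
      rw [indicator_of_mem h1, indicator_of_mem h2, key s hs, key t ht,
        ← Real.mul_rpow (by positivity) (by positivity), regionKernel, if_pos ⟨⟨hs, ht⟩, h⟩, abs_one]
      refine Real.one_le_rpow_of_pos_of_le_one_of_nonpos (by positivity) ?_ (by norm_num)
      have h3 := mul_exp_half_le_exp_sub_one hs.le
      have h4 := mul_exp_half_le_exp_sub_one ht.le
      have h5 : Real.exp s * Real.exp t < Real.exp s + Real.exp t := by
        rw [Real.exp_neg, Real.exp_neg] at h
        have := mul_lt_mul_of_pos_right h (mul_pos (Real.exp_pos s) (Real.exp_pos t))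
        field_simp at this
        linarith
      calc s * Real.exp (s / 2) * (t * Real.exp (t / 2))
          ≤ (Real.exp s - 1) * (Real.exp t - 1) :=
            mul_le_mul h3 h4 (by positivity) (by linarith [Real.one_lt_exp_iff.mpr hs])
        _ ≤ 1 := by nlinarith
    · rw [regionKernel, if_neg hst, abs_zero]
      exact mul_nonneg (indicator_nonneg (fun x hx => by have := mem_Ioi.mp hx; positivity) _)
        (indicator_nonneg (fun x hx => by have := mem_Ioi.mp hx; positivity) _)
  diag v hv := by
    -- The line meets the region in an interval whose length is the required logarithm.
    have h1 : (fun t => regionKernel (t + v, t)) =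
        (Ioo (0 : ℝ) (Real.log (1 + Real.exp (-v)))).indicator fun _ => 1 := by
      ext t
      have h2 : t < Real.log (1 + Real.exp (-v)) ↔ 1 < Real.exp (-(t + v)) + Real.exp (-t) := by
        rw [Real.lt_log_iff_exp_lt (by positivity), neg_add, Real.exp_add, Real.exp_neg t]
        have := Real.exp_pos t
        constructor
        · intro h
          field_simp
          linarith
        · intro h
          field_simp at h
          linarith
      rw [indicator_apply, regionKernel]
      refine if_congr ?_ rfl rfl
      simp only [mem_Ioo, h2]
      exact ⟨fun h => ⟨h.1.2, h.2⟩, fun h => ⟨⟨by linarith [h.1], h.1⟩, h.2⟩⟩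
    rw [h1, integral_indicator measurableSet_Ioo]
    have : 0 ≤ Real.log (1 + Real.exp (-v)) := Real.log_nonneg (by linarith [Real.exp_pos (-v)])
    simp [this]

/-! ### Multiple zeta values as moments of the region kernel -/

/-- Strictly increasing tuples of positive integers, the summation range of `multiZeta`. -/
abbrev PosStrictTuple (r : ℕ) := {m : Fin r → ℕ // (∀ i, 0 < m i) ∧ StrictMono m}

/-- A strictly increasing tuple is determined by its initial part and the last gap. -/
def PosStrictTuple.snocEquiv (a : ℕ) : PosStrictTuple (a + 1) × ℕ ≃ PosStrictTuple (a + 2) where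
  toFun q := ⟨Fin.snoc (α := fun _ => ℕ) q.1.1 (q.1.1 (Fin.last a) + q.2 + 1), by
    constructor
    · intro i
      refine Fin.lastCases ?_ (fun j => ?_) i
      · rw [Fin.snoc_last]; omega
      · rw [Fin.snoc_castSucc]; exact q.1.2.1 j
    · rw [Fin.strictMono_iff_lt_succ]
      intro i
      rw [Fin.snoc_castSucc]
      refine Fin.lastCases ?_ (fun j => ?_) i
      · rw [Fin.succ_last, Fin.snoc_last]; omega
      · rw [← Fin.castSucc_succ, Fin.snoc_castSucc]
        exact q.1.2.2 Fin.castSucc_lt_succ⟩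
  invFun m := (⟨fun i => m.1 i.castSucc, fun i => m.2.1 _,
    m.2.2.comp (Fin.strictMono_castSucc)⟩,
    m.1 (Fin.last (a + 1)) - m.1 (Fin.last a).castSucc - 1)
  left_inv q := by
    refine Prod.ext (Subtype.ext (funext fun i => ?_)) ?_
    · simp
    · simp only [Fin.snoc_last, Fin.snoc_castSucc]; omega
  right_inv m := by
    refine Subtype.ext (funext fun i => ?_)
    have h : m.1 (Fin.last a).castSucc < m.1 (Fin.last (a + 1)) := m.2.2 (Fin.castSucc_lt_last _)
    refine Fin.lastCases ?_ (fun j => ?_) i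
    · simp only [Fin.snoc_last]; omega
    · simp only [Fin.snoc_castSucc]

/-- Strictly increasing tuples of length one are positive integers. -/
def PosStrictTuple.oneEquiv : ℕ ≃ PosStrictTuple 1 where
  toFun n := ⟨fun _ => n + 1, fun _ => n.succ_pos, Subsingleton.strictMono _⟩
  invFun m := m.1 0 - 1
  left_inv n := by simp
  right_inv m := by
    refine Subtype.ext (funext fun i => ?_)
    have := m.2.1 0
    rw [Subsingleton.elim i 0]
    simp only
    omega

/-- The series `∑ e^{-m_{a+1} t} / (m₁ ⋯ m_{a+1})` over `0 < m₁ < ⋯ < m_{a+1}`. -/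
noncomputable def expMultiSum (a : ℕ) (t : ℝ) : ENNReal :=
  ∑' m : PosStrictTuple (a + 1),
    ENNReal.ofReal ((∏ i, (m.1 i : ℝ))⁻¹ * Real.exp (-(m.1 (Fin.last a)) * t))

/-- The function `-log (1 - e^{-t})`. -/
noncomputable def negLogOneSubExp (t : ℝ) : ℝ := -Real.log (1 - Real.exp (-t))

theorem one_sub_exp_neg_pos {t : ℝ} (ht : 0 < t) : 0 < 1 - Real.exp (-t) := by
  rw [sub_pos, Real.exp_lt_one_iff]; linarith

theorem negLogOneSubExp_pos {t : ℝ} (ht : 0 < t) : 0 < negLogOneSubExp t :=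
  neg_pos.mpr (Real.log_neg (one_sub_exp_neg_pos ht) (by linarith [Real.exp_pos (-t)]))

theorem hasDerivAt_negLogOneSubExp {t : ℝ} (ht : 0 < t) :
    HasDerivAt negLogOneSubExp (-(1 / (Real.exp t - 1))) t := by
  have h := one_sub_exp_neg_pos ht
  have h1 := ((((hasDerivAt_neg t).exp).const_sub 1).log h.ne').neg
  convert! h1 using 1
  have h2 : Real.exp t - 1 ≠ 0 := by linarith [Real.one_lt_exp_iff.mpr ht]
  rw [Real.exp_neg] at h ⊢
  have h3 : 1 - (Real.exp t)⁻¹ = (Real.exp t - 1) / Real.exp t := by field_simp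
  rw [h3]
  field_simp

theorem tendsto_negLogOneSubExp_atTop :
    Filter.Tendsto negLogOneSubExp Filter.atTop (nhds 0) := by
  have h1 : Filter.Tendsto (fun t : ℝ => 1 - Real.exp (-t)) Filter.atTop (nhds (1 - 0)) :=
    Real.tendsto_exp_neg_atTop_nhds_zero.const_sub 1
  have h2 := (h1.log (by simp)).neg
  simp only [sub_zero, Real.log_one, neg_zero] at h2
  exact h2

theorem lintegral_Ioi_ofReal_of_hasDerivAt_neg {f f' : ℝ → ℝ} {a : ℝ}
    (hd : ∀ x ∈ Ici a, HasDerivAt f (-f' x) x) (hf' : ∀ x ∈ Ioi a, 0 ≤ f' x)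
    (hlim : Filter.Tendsto f Filter.atTop (nhds 0)) :
    ∫⁻ x in Ioi a, ENNReal.ofReal (f' x) = ENNReal.ofReal (f a) := by
  have hd' : ∀ x ∈ Ici a, HasDerivAt (fun x => -f x) (f' x) x := fun x hx => by
    simpa only [neg_neg] using (hd x hx).fun_neg
  have hlim' : Filter.Tendsto (fun x => -f x) Filter.atTop (nhds 0) := by simpa using hlim.neg
  rw [← ofReal_integral_eq_lintegral_ofReal (integrableOn_Ioi_deriv_of_nonneg' hd' hf' hlim')
    ((ae_restrict_mem measurableSet_Ioi).mono hf'),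
    integral_Ioi_of_hasDerivAt_of_nonneg' hd' hf' hlim']
  simp

theorem lintegral_Ioi_exp_neg_mul {c : ℝ} (hc : 0 < c) (t : ℝ) :
    ∫⁻ x in Ioi t, ENNReal.ofReal (Real.exp (-c * x)) =
      ENNReal.ofReal (Real.exp (-c * t) / c) := by
  refine lintegral_Ioi_ofReal_of_hasDerivAt_neg (f := fun x => Real.exp (-c * x) / c)
    (fun x _ => ?_) (fun x _ => (Real.exp_pos _).le) ?_
  · convert! (((hasDerivAt_id x).const_mul (-c)).exp.div_const c) using 1
    simp only [id]
    field_simp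
  · have h : Filter.Tendsto (fun x : ℝ => -(c * x)) Filter.atTop Filter.atBot :=
      Filter.tendsto_neg_atTop_atBot.comp (Filter.tendsto_id.const_mul_atTop hc)
    simpa [neg_mul] using (Real.tendsto_exp_atBot.comp h).div_const c

/-- The geometric series over all possible values of a new largest summation variable, given the
previous one `M`. -/
theorem tsum_ofReal_exp_neg_add_one_mul {t : ℝ} (ht : 0 < t) (M : ℕ) :
    ∑' j : ℕ, ENNReal.ofReal (Real.exp (-((M + j + 1 : ℕ) : ℝ) * t)) =
      ENNReal.ofReal (Real.exp (-M * t) * (1 / (Real.exp t - 1))) := by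
  have h1 : ∀ j : ℕ, Real.exp (-((M + j + 1 : ℕ) : ℝ) * t) =
      Real.exp (-M * t) * Real.exp (-t) * Real.exp (-t) ^ j := fun j => by
    rw [← Real.exp_nat_mul, ← Real.exp_add, ← Real.exp_add]
    push_cast
    ring_nf
  have h2 := (hasSum_geometric_of_lt_one (Real.exp_pos (-t)).le
    (Real.exp_lt_one_iff.mpr (neg_lt_zero.mpr ht))).mul_left (Real.exp (-M * t) * Real.exp (-t))
  simp_rw [h1]
  rw [← ENNReal.ofReal_tsum_of_nonneg (fun j => by positivity) h2.summable, h2.tsum_eq]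
  congr 1
  have h3 : Real.exp t - 1 ≠ 0 := by linarith [Real.one_lt_exp_iff.mpr ht]
  have h4 : 1 - Real.exp (-t) = (Real.exp t - 1) / Real.exp t := by
    rw [Real.exp_neg]; field_simp
  rw [h4, Real.exp_neg t]
  field_simp

theorem expMultiSum_zero {t : ℝ} (ht : 0 < t) :
    expMultiSum 0 t = ENNReal.ofReal (negLogOneSubExp t) := by
  rw [expMultiSum, ← PosStrictTuple.oneEquiv.tsum_eq]
  have h1 : |Real.exp (-t)| < 1 := by
    rw [abs_of_pos (Real.exp_pos _), Real.exp_lt_one_iff]; linarith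
  have h2 := Real.hasSum_pow_div_log_of_abs_lt_one h1
  rw [negLogOneSubExp, ← h2.tsum_eq,
    ENNReal.ofReal_tsum_of_nonneg (fun j => by positivity) h2.summable]
  congr 1 with j
  congr 1
  simp only [PosStrictTuple.oneEquiv, Equiv.coe_fn_mk, Finset.prod_const, Finset.card_univ,
    Fintype.card_fin, zero_add, pow_one]
  rw [← Real.exp_nat_mul, div_eq_inv_mul]
  push_cast
  ring_nf

/-- The factor `1/(e^x - 1)` creates a new largest variable `n` through the geometric series, and
integrating `e^{-nx}` over `x > t` supplies its `1/n`. Working in `ENNReal` makes every interchange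
free. -/
theorem expMultiSum_succ (a : ℕ) {t : ℝ} (ht : 0 < t) :
    expMultiSum (a + 1) t =
      ∫⁻ x in Ioi t, expMultiSum a x * ENNReal.ofReal (1 / (Real.exp x - 1)) := by
  have h1 : ∀ x ∈ Ioi t, expMultiSum a x * ENNReal.ofReal (1 / (Real.exp x - 1)) =
      ∑' m : PosStrictTuple (a + 1), ∑' j : ℕ, ENNReal.ofReal ((∏ i, (m.1 i : ℝ))⁻¹) *
        ENNReal.ofReal (Real.exp (-((m.1 (Fin.last a) + j + 1 : ℕ) : ℝ) * x)) := fun x hx => by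
    rw [expMultiSum, ← ENNReal.tsum_mul_right]
    congr 1 with m
    rw [ENNReal.tsum_mul_left, tsum_ofReal_exp_neg_add_one_mul (ht.trans hx),
      ENNReal.ofReal_mul (by positivity), ENNReal.ofReal_mul (by positivity), mul_assoc]
  rw [setLIntegral_congr_fun measurableSet_Ioi h1, lintegral_tsum]
  · rw [expMultiSum, ← (PosStrictTuple.snocEquiv a).tsum_eq, ENNReal.tsum_prod']
    congr 1 with m
    rw [lintegral_tsum (fun j => by fun_prop)]
    congr 1 with j
    rw [lintegral_const_mul _ (by fun_prop), lintegral_Ioi_exp_neg_mul (by positivity),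
      ← ENNReal.ofReal_mul (by positivity)]
    congr 1
    simp only [PosStrictTuple.snocEquiv, Equiv.coe_fn_mk]
    rw [Fin.prod_univ_castSucc]
    simp only [Fin.snoc_last, Fin.snoc_castSucc]
    rw [mul_inv]
    ring
  · intro m
    exact (Measurable.tsum fun j => by fun_prop).aemeasurable

/-- Since `negLogOneSubExp` has derivative `-1/(e^x - 1)`, the recursion integrates exactly and
raises the divided power by one. -/
theorem expMultiSum_eq (a : ℕ) {t : ℝ} (ht : 0 < t) :
    expMultiSum a t = ENNReal.ofReal (negLogOneSubExp t ^ (a + 1) / (a + 1).factorial) := by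
  induction a generalizing t with
  | zero => simpa using expMultiSum_zero ht
  | succ a ih =>
    have h1 : ∀ x ∈ Ioi t, expMultiSum a x * ENNReal.ofReal (1 / (Real.exp x - 1)) =
        ENNReal.ofReal (negLogOneSubExp x ^ (a + 1) / (a + 1).factorial *
          (1 / (Real.exp x - 1))) := fun x hx => by
      have hx0 := ht.trans hx
      have := negLogOneSubExp_pos hx0
      rw [ih hx0, ENNReal.ofReal_mul (by positivity)]
    rw [expMultiSum_succ a ht, setLIntegral_congr_fun measurableSet_Ioi h1]
    refine lintegral_Ioi_ofReal_of_hasDerivAt_neg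
      (f := fun x => negLogOneSubExp x ^ (a + 2) / (a + 2).factorial) (fun x hx => ?_)
      (fun x hx => ?_) ?_
    · convert! ((hasDerivAt_negLogOneSubExp (ht.trans_le hx)).pow (a + 2)).div_const _ using 1
      rw [Nat.factorial_succ (a + 1)]
      push_cast
      field_simp
      ring
    · have hx0 := ht.trans hx
      have := negLogOneSubExp_pos hx0
      have h2 := Real.one_lt_exp_iff.mpr hx0
      have h3 : 0 < Real.exp x - 1 := by linarith
      positivity
    · simpa using (tendsto_negLogOneSubExp_atTop.pow (a + 2)).div_const _

theorem lintegral_Ioi_pow_mul_exp_neg_mul (b : ℕ) {c : ℝ} (hc : 0 < c) :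
    ∫⁻ t in Ioi (0 : ℝ), ENNReal.ofReal (t ^ b / b.factorial * Real.exp (-c * t)) =
      ENNReal.ofReal ((c ^ (b + 1))⁻¹) := by
  rw [← ofReal_integral_eq_lintegral_ofReal]
  · congr 1
    have h := Real.integral_rpow_mul_exp_neg_mul_Ioi (a := b + 1) (by positivity) hc
    rw [Real.Gamma_nat_eq_factorial, ← Nat.cast_add_one, Real.rpow_natCast] at h
    simp only [Nat.cast_add_one, add_sub_cancel_right, Real.rpow_natCast] at h
    simp_rw [div_mul_eq_mul_div, neg_mul]
    rw [integral_div, h, one_div, inv_pow, mul_div_assoc, div_self (by positivity), mul_one]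
  · have := (integrableOn_pow_mul_exp_neg b hc).div_const (b.factorial : ℝ)
    simpa only [div_mul_eq_mul_div] using this
  · filter_upwards [ae_restrict_mem measurableSet_Ioi] with t ht
    have := mem_Ioi.mp ht
    positivity

/-- Integration against `t^b/b!` turns `e^{-mt}` into `m^{-(b+1)}`; with the `1/m` already in
`expMultiSum` the last exponent becomes `b + 2`. -/
theorem tsum_ofReal_mzvTerm_onesThen (a b : ℕ) :
    ∑' m, ENNReal.ofReal (mzvTerm (onesThen a (b + 2)) m) =
      ∫⁻ t in Ioi (0 : ℝ), ENNReal.ofReal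
        (t ^ b / b.factorial * (negLogOneSubExp t ^ (a + 1) / (a + 1).factorial)) := by
  have h1 : ∀ t ∈ Ioi (0 : ℝ), ENNReal.ofReal
      (t ^ b / b.factorial * (negLogOneSubExp t ^ (a + 1) / (a + 1).factorial)) =
      ∑' m : PosStrictTuple (a + 1), ENNReal.ofReal ((∏ i, (m.1 i : ℝ))⁻¹) *
        ENNReal.ofReal (t ^ b / b.factorial * Real.exp (-(m.1 (Fin.last a)) * t)) := fun t ht => by
    have ht' := mem_Ioi.mp ht
    rw [ENNReal.ofReal_mul (by positivity), ← expMultiSum_eq a ht, expMultiSum,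
      ← ENNReal.tsum_mul_left]
    congr 1 with m
    rw [← ENNReal.ofReal_mul (by positivity), ← ENNReal.ofReal_mul (by positivity)]
    congr 1
    ring
  rw [setLIntegral_congr_fun measurableSet_Ioi h1, lintegral_tsum (fun m => by fun_prop)]
  congr 1 with m
  have hm : (0 : ℝ) < m.1 (Fin.last a) := Nat.cast_pos.mpr (m.2.1 _)
  rw [lintegral_const_mul _ (by fun_prop), lintegral_Ioi_pow_mul_exp_neg_mul b hm,
    ← ENNReal.ofReal_mul (by positivity), mzvTerm, Fin.prod_univ_castSucc, Fin.prod_univ_castSucc]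
  congr 1
  simp only [onesThen, Fin.snoc_castSucc, Fin.snoc_last, pow_one]
  rw [one_div, ← mul_inv]
  congr 1
  ring

/-- The slice of the region at height `t` is the interval `0 < s < negLogOneSubExp t`. -/
theorem integral_regionKernel_slice (a : ℕ) {t : ℝ} (ht : 0 < t) :
    ∫ s, s ^ a / a.factorial * regionKernel (t, s) =
      negLogOneSubExp t ^ (a + 1) / (a + 1).factorial := by
  have h1 : (fun s => s ^ a / a.factorial * regionKernel (t, s)) =
      (Ioo 0 (negLogOneSubExp t)).indicator fun s => s ^ a / a.factorial := by
    ext s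
    have h2 : s < negLogOneSubExp t ↔ 1 < Real.exp (-t) + Real.exp (-s) := by
      rw [add_comm]
      exact lt_neg_log_one_sub_iff (Real.exp_lt_one_iff.mpr (neg_lt_zero.mpr ht))
    rw [indicator_apply, regionKernel]
    simp only [mul_ite, mul_one, mul_zero, mem_Ioo, h2, ht, true_and]
  have h3 := negLogOneSubExp_pos ht
  rw [h1, integral_indicator measurableSet_Ioo, ← integral_Ioc_eq_integral_Ioo,
    ← intervalIntegral.integral_of_le h3.le, intervalIntegral.integral_div, integral_pow,
    Nat.factorial_succ]
  push_cast
  rw [zero_pow (by omega)]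
  field_simp
  ring

theorem regionKernel_of_fst_nonpos {t : ℝ} (ht : ¬ 0 < t) (s : ℝ) : regionKernel (t, s) = 0 :=
  if_neg fun h => ht h.1.1

theorem integral_regionKernel_slice_eq_indicator (b a : ℕ) :
    (fun t => ∫ s, t ^ b / b.factorial * (s ^ a / a.factorial) * regionKernel (t, s)) =
      (Ioi (0 : ℝ)).indicator fun t =>
        t ^ b / b.factorial * (negLogOneSubExp t ^ (a + 1) / (a + 1).factorial) := by
  ext t
  by_cases ht : 0 < t
  · rw [indicator_of_mem (mem_Ioi.mpr ht), ← integral_regionKernel_slice a ht,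
      ← integral_const_mul]
    simp_rw [mul_assoc]
  · rw [indicator_of_notMem (by simpa using ht)]
    simp [regionKernel_of_fst_nonpos ht]

theorem integrableOn_pow_mul_negLogOneSubExp (b a : ℕ) :
    IntegrableOn (fun t => t ^ b / b.factorial *
      (negLogOneSubExp t ^ (a + 1) / (a + 1).factorial)) (Ioi 0) := by
  rw [← integrable_indicator_iff measurableSet_Ioi, ← integral_regionKernel_slice_eq_indicator]
  exact (isDiagKernel_regionKernel.integrable_moment b a).integral_prod_left

theorem kernelMoment_regionKernel (b a : ℕ) :
    kernelMoment regionKernel b a = ∫ t in Ioi (0 : ℝ), t ^ b / b.factorial *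
      (negLogOneSubExp t ^ (a + 1) / (a + 1).factorial) := by
  rw [kernelMoment, Measure.volume_eq_prod,
    integral_prod _ (isDiagKernel_regionKernel.integrable_moment b a),
    ← integral_indicator measurableSet_Ioi, ← integral_regionKernel_slice_eq_indicator]

theorem hasSum_mzvTerm_onesThen (a b : ℕ) :
    HasSum (mzvTerm (onesThen a (b + 2))) (kernelMoment regionKernel b a) := by
  have h0 : ∀ m, 0 ≤ mzvTerm (onesThen a (b + 2)) m := fun m => by
    unfold mzvTerm; positivity
  have hpos : ∀ t ∈ Ioi (0 : ℝ), 0 ≤ t ^ b / b.factorial *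
      (negLogOneSubExp t ^ (a + 1) / (a + 1).factorial) := fun t ht => by
    have := negLogOneSubExp_pos ht
    have := mem_Ioi.mp ht
    positivity
  have h := tsum_ofReal_mzvTerm_onesThen a b
  rw [← ofReal_integral_eq_lintegral_ofReal (integrableOn_pow_mul_negLogOneSubExp b a)
    ((ae_restrict_mem measurableSet_Ioi).mono hpos), ← kernelMoment_regionKernel] at h
  -- Convergence comes from the identity in `ENNReal`: its other side is finite because the kernel
  -- moment is integrable.
  have hs : Summable (mzvTerm (onesThen a (b + 2))) := by
    have := ENNReal.summable_toReal (h.trans_ne ENNReal.ofReal_ne_top)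
    simpa only [ENNReal.toReal_ofReal (h0 _)] using this
  rw [← ENNReal.ofReal_tsum_of_nonneg h0 hs] at h
  have hk : 0 ≤ kernelMoment regionKernel b a := by
    rw [kernelMoment_regionKernel]
    exact setIntegral_nonneg measurableSet_Ioi hpos
  rw [← (ENNReal.ofReal_eq_ofReal_iff (tsum_nonneg h0) hk).mp h]
  exact hs.hasSum

theorem multiZeta_onesThen_eq (a b : ℕ) :
    multiZeta (onesThen a (b + 2)) = kernelMoment regionKernel b a :=
  (hasSum_mzvTerm_onesThen a b).tsum_eq

/-! ### Evaluation of the common integral -/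

theorem multiZeta_onesThen_zero (n : ℕ) :
    (multiZeta (onesThen 0 (n + 2)) : ℂ) = riemannZeta (n + 2) := by
  have h := zeta_nat_eq_tsum_of_gt_one (k := n + 2) (by omega)
  push_cast at h
  rw [h, multiZeta, ← PosStrictTuple.oneEquiv.tsum_eq]
  have h1 : ∀ j : ℕ, mzvTerm (onesThen 0 (n + 2)) (PosStrictTuple.oneEquiv j) =
      1 / ((j + 1 : ℕ) : ℝ) ^ (n + 2) := fun j => by
    simp only [mzvTerm, PosStrictTuple.oneEquiv, Equiv.coe_fn_mk]
    rw [Fin.prod_univ_castSucc, Finset.univ_eq_empty, Finset.prod_empty, one_mul, onesThen,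
      Fin.snoc_last]
  have hs : Summable fun j : ℕ => 1 / (j : ℝ) ^ (n + 2) :=
    Real.summable_one_div_nat_pow.mpr (by omega)
  have h2 := hs.tsum_eq_zero_add
  simp_rw [h1]
  rw [show (∑' j : ℕ, 1 / ((j + 1 : ℕ) : ℝ) ^ (n + 2)) = ∑' j : ℕ, 1 / (j : ℝ) ^ (n + 2) by
    rw [h2]; simp]
  push_cast
  rfl

theorem log_one_add_exp_neg {v : ℝ} (hv : 0 < v) :
    Real.log (1 + Real.exp (-v)) = negLogOneSubExp v - negLogOneSubExp (2 * v) := by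
  have h1 := one_sub_exp_neg_pos hv
  have h2 : 1 - Real.exp (-(2 * v)) = (1 - Real.exp (-v)) * (1 + Real.exp (-v)) := by
    rw [show -(2 * v) = -v + -v by ring, Real.exp_add]; ring
  rw [negLogOneSubExp, negLogOneSubExp, h2, Real.log_mul h1.ne' (by positivity)]
  ring

/-- Uses `log (1 + e^{-v}) = L(v) - L(2v)` with `L = negLogOneSubExp`. The substitution `v ↦ 2v`
scales the second integral by `2^{-(k+1)}`. -/
theorem integral_pow_mul_log_one_add_exp_neg (k : ℕ) :
    ∫ v in Ioi (0 : ℝ), v ^ k / k.factorial * Real.log (1 + Real.exp (-v)) =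
      (1 - 1 / 2 ^ (k + 1)) * multiZeta (onesThen 0 (k + 2)) := by
  set f : ℝ → ℝ := fun v => v ^ k / k.factorial * negLogOneSubExp v with hf
  have hi : IntegrableOn f (Ioi 0) := by
    simpa using integrableOn_pow_mul_negLogOneSubExp k 0
  have hz : multiZeta (onesThen 0 (k + 2)) = ∫ v in Ioi (0 : ℝ), f v := by
    rw [multiZeta_onesThen_eq, kernelMoment_regionKernel]
    simp [hf]
  have hi2 : IntegrableOn (fun v => f (2 * v)) (Ioi 0) := by
    rw [integrableOn_Ioi_comp_mul_left_iff f 0 two_pos]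
    simpa using hi
  have h2 := integral_comp_mul_left_Ioi f 0 two_pos
  rw [mul_zero, smul_eq_mul] at h2
  have h3 : ∀ v ∈ Ioi (0 : ℝ), v ^ k / k.factorial * Real.log (1 + Real.exp (-v)) =
      f v - (1 / 2 ^ k) * f (2 * v) := fun v hv => by
    rw [log_one_add_exp_neg hv, hf]
    simp only [mul_pow]
    field_simp
  rw [setIntegral_congr_fun measurableSet_Ioi h3, integral_sub hi (hi2.const_mul _),
    integral_const_mul, h2, hz, pow_succ]
  field_simp

/-! ### The polylogarithm on the negative half-line -/

theorem integrableOn_pow_mul_of_le_exp_neg {f : ℝ → ℝ} (n : ℕ) {C : ℝ}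
    (hf : ContinuousOn f (Ioi 0)) (hle : ∀ s, 0 < s → |f s| ≤ C * Real.exp (-s)) :
    IntegrableOn (fun s => s ^ n / n.factorial * f s) (Ioi 0) := by
  have h1 := (integrableOn_pow_mul_exp_neg n one_pos).const_mul (C / n.factorial)
  refine h1.mono' ?_ ?_
  · exact ContinuousOn.aestronglyMeasurable (by fun_prop) measurableSet_Ioi
  · filter_upwards [ae_restrict_mem measurableSet_Ioi] with s hs
    have hs' := mem_Ioi.mp hs
    rw [Real.norm_eq_abs, abs_mul, abs_of_pos (by positivity)]
    calc s ^ n / n.factorial * |f s| ≤ s ^ n / n.factorial * (C * Real.exp (-s)) := by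
          gcongr; exact hle s hs'
      _ = _ := by rw [neg_one_mul]; ring

section

variable {z : ℝ}

theorem exp_sub_pos (hz : z ≤ 0) (s : ℝ) : 0 < Real.exp s - z := by
  linarith [Real.exp_pos s]

theorem one_sub_mul_exp_neg_pos (hz : z ≤ 0) (s : ℝ) : 0 < 1 - z * Real.exp (-s) := by
  nlinarith [Real.exp_pos (-s)]

theorem one_div_exp_sub_le (hz : z ≤ 0) (s : ℝ) : 1 / (Real.exp s - z) ≤ Real.exp (-s) := by
  rw [Real.exp_neg, ← one_div]
  exact one_div_le_one_div_of_le (Real.exp_pos s) (by linarith)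

theorem abs_div_exp_sub_le (hz : z ≤ 0) (s : ℝ) :
    |z / (Real.exp s - z)| ≤ -z * Real.exp (-s) := by
  rw [abs_div, abs_of_nonpos hz, abs_of_pos (exp_sub_pos hz s), div_eq_mul_one_div]
  exact mul_le_mul_of_nonneg_left (one_div_exp_sub_le hz s) (by linarith)

theorem abs_log_one_sub_mul_exp_neg_le (hz : z ≤ 0) (s : ℝ) :
    |Real.log (1 - z * Real.exp (-s))| ≤ -z * Real.exp (-s) := by
  have h := Real.exp_pos (-s)
  rw [abs_of_nonneg (Real.log_nonneg (by nlinarith))]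
  linarith [Real.log_le_sub_one_of_pos (one_sub_mul_exp_neg_pos hz s)]

theorem hasDerivAt_log_one_sub_mul_exp_neg (hz : z ≤ 0) (s : ℝ) :
    HasDerivAt (fun s => Real.log (1 - z * Real.exp (-s))) (z / (Real.exp s - z)) s := by
  have h1 := one_sub_mul_exp_neg_pos hz s
  convert! (((hasDerivAt_neg s).exp.const_mul z).const_sub 1).log h1.ne' using 1
  have h2 := exp_sub_pos hz s
  have h3 : 1 - z * Real.exp (-s) = (Real.exp s - z) / Real.exp s := by
    rw [Real.exp_neg]; field_simp
  rw [h3, Real.exp_neg]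
  field_simp

theorem continuous_div_exp_sub (hz : z ≤ 0) : Continuous fun s => z / (Real.exp s - z) :=
  continuous_const.div (by fun_prop) fun s => (exp_sub_pos hz s).ne'

theorem continuous_log_one_sub_mul_exp_neg (hz : z ≤ 0) :
    Continuous fun s => Real.log (1 - z * Real.exp (-s)) :=
  continuous_iff_continuousAt.mpr fun s => (hasDerivAt_log_one_sub_mul_exp_neg hz s).continuousAt

theorem integral_Ioi_div_exp_sub (hz : z ≤ 0) :
    ∫ s in Ioi (0 : ℝ), z / (Real.exp s - z) = -Real.log (1 - z) := by
  have hlim : Filter.Tendsto (fun s => Real.log (1 - z * Real.exp (-s))) Filter.atTop (nhds 0) := by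
    have h1 : Filter.Tendsto (fun s => 1 - z * Real.exp (-s)) Filter.atTop (nhds (1 - z * 0)) :=
      (Real.tendsto_exp_neg_atTop_nhds_zero.const_mul z).const_sub 1
    simpa using h1.log (by simp)
  rw [integral_Ioi_of_hasDerivAt_of_nonpos'
    (fun s _ => hasDerivAt_log_one_sub_mul_exp_neg hz s) _ hlim]
  · simp
  · exact fun s _ => div_nonpos_of_nonpos_of_nonneg hz (exp_sub_pos hz s).le

/-- Integration by parts; it restores the shape of the integral representation of `polyLi` after
each induction step. -/
theorem integral_Ioi_pow_mul_log (hz : z ≤ 0) (r : ℕ) :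
    ∫ s in Ioi (0 : ℝ), s ^ r / r.factorial * -Real.log (1 - z * Real.exp (-s)) =
      ∫ s in Ioi (0 : ℝ), s ^ (r + 1) / (r + 1).factorial * (z / (Real.exp s - z)) := by
  set u : ℝ → ℝ := fun s => s ^ (r + 1) / (r + 1).factorial with hu
  set G : ℝ → ℝ := fun s => Real.log (1 - z * Real.exp (-s)) with hG
  have hcG : Continuous G := continuous_log_one_sub_mul_exp_neg hz
  have hdu : ∀ s ∈ Ioi (0 : ℝ), HasDerivAt u (s ^ r / r.factorial) s := fun s _ => by
    convert! (hasDerivAt_pow (r + 1) s).div_const ((r + 1).factorial : ℝ) using 1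
    rw [Nat.factorial_succ]
    push_cast
    field_simp
  have h0 : Filter.Tendsto (u * G) (nhdsWithin 0 (Ioi 0)) (nhds 0) := by
    have hc : Continuous (u * G) := Continuous.mul (by fun_prop) hcG
    have := hc.tendsto 0
    simp only [Pi.mul_apply, hu] at this
    rw [zero_pow (by omega), zero_div, zero_mul] at this
    exact this.mono_left nhdsWithin_le_nhds
  have hinf : Filter.Tendsto (u * G) Filter.atTop (nhds 0) := by
    have h1 := (Real.tendsto_pow_mul_exp_neg_atTop_nhds_zero (r + 1)).const_mul
      (-z / (r + 1).factorial)
    rw [mul_zero] at h1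
    refine squeeze_zero_norm' ?_ h1
    filter_upwards [Filter.eventually_ge_atTop 0] with s hs
    rw [Pi.mul_apply, Real.norm_eq_abs, abs_mul, abs_of_nonneg (show 0 ≤ u s by positivity)]
    calc u s * |G s| ≤ u s * (-z * Real.exp (-s)) := by
          gcongr; exact abs_log_one_sub_mul_exp_neg_le hz s
      _ = _ := by rw [hu]; ring
  have h := integral_Ioi_mul_deriv_eq_deriv_mul hdu
    (fun s _ => hasDerivAt_log_one_sub_mul_exp_neg hz s)
    (integrableOn_pow_mul_of_le_exp_neg (r + 1) (continuous_div_exp_sub hz).continuousOn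
      fun s _ => abs_div_exp_sub_le hz s)
    (integrableOn_pow_mul_of_le_exp_neg r hcG.continuousOn
      fun s _ => abs_log_one_sub_mul_exp_neg_le hz s) h0 hinf
  rw [h]
  simp_rw [mul_neg]
  rw [integral_neg]
  simp

theorem setIntegral_one_div_exp_sub (hz : z ≤ 0) (s : ℝ) :
    ∫ w in Ioo z 0, 1 / (Real.exp s - w) = Real.log (1 - z * Real.exp (-s)) := by
  have hd : ∀ w ∈ uIcc z 0, HasDerivAt (fun w => -Real.log (Real.exp s - w))
      (1 / (Real.exp s - w)) w := fun w hw => by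
    rw [uIcc_of_le hz] at hw
    have := exp_sub_pos hw.2 s
    convert! (((hasDerivAt_id w).const_sub (Real.exp s)).log this.ne').neg using 1
    simp only [id]
    ring
  rw [← integral_Ioc_eq_integral_Ioo, ← intervalIntegral.integral_of_le hz,
    intervalIntegral.integral_eq_sub_of_hasDerivAt hd]
  · rw [sub_zero, neg_sub_neg, ← Real.log_div (exp_sub_pos hz s).ne' (Real.exp_pos s).ne',
      Real.exp_neg]
    congr 1
    have := Real.exp_pos s
    field_simp
  · refine ContinuousOn.intervalIntegrable (ContinuousOn.div (by fun_prop) (by fun_prop) ?_)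
    intro w hw
    rw [uIcc_of_le hz] at hw
    exact (exp_sub_pos hw.2 s).ne'

theorem integrable_pow_mul_one_div_exp_sub_prod (z : ℝ) (r : ℕ) :
    Integrable (Function.uncurry fun w s : ℝ => s ^ r / r.factorial * (1 / (Real.exp s - w)))
      ((volume.restrict (Ioo z 0)).prod (volume.restrict (Ioi 0))) := by
  have h1 : Integrable (fun _ : ℝ => (1 : ℝ)) (volume.restrict (Ioo z 0)) := integrable_const 1
  have h2 := h1.mul_prod
    ((integrableOn_pow_mul_exp_neg r one_pos).integrable.const_mul (1 / r.factorial))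
  refine h2.mono' (Measurable.aestronglyMeasurable (by unfold Function.uncurry; fun_prop)) ?_
  rw [Measure.prod_restrict]
  filter_upwards [ae_restrict_mem (measurableSet_Ioo.prod measurableSet_Ioi)] with p hp
  have hs : 0 < p.2 := hp.2
  have hw : p.1 ≤ 0 := hp.1.2.le
  have := exp_sub_pos hw p.2
  rw [Function.uncurry, Real.norm_eq_abs, abs_of_nonneg (by positivity)]
  calc p.2 ^ r / r.factorial * (1 / (Real.exp p.2 - p.1))
      ≤ p.2 ^ r / r.factorial * Real.exp (-p.2) := by
        gcongr; exact one_div_exp_sub_le hw p.2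
    _ = _ := by rw [neg_one_mul]; ring

theorem polyLi_succ_eq_neg_setIntegral (hz : z ≤ 0) (n : ℕ) :
    polyLi (n + 1) z = -∫ w in Ioo z 0, polyLi n w / w := by
  rw [polyLi, intervalIntegral.integral_of_ge hz, integral_Ioc_eq_integral_Ioo]

/-- An integral representation of the polylogarithm on the negative half-line. -/
theorem polyLi_succ_eq_integral (r : ℕ) (hz : z < 0) :
    polyLi (r + 1) z =
      ∫ s in Ioi (0 : ℝ), s ^ r / r.factorial * (z / (Real.exp s - z)) := by
  induction r generalizing z with
  | zero =>
    -- Writing `1` as `e^0` lets the `w`-integral be read off at `s = 0`.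
    have h1 : ∀ w ∈ Ioo z 0, polyLi 0 w / w = 1 / (Real.exp 0 - w) := fun w hw => by
      have := hw.2.ne
      rw [polyLi, Real.exp_zero]
      field_simp
    rw [polyLi_succ_eq_neg_setIntegral hz.le, setIntegral_congr_fun measurableSet_Ioo h1,
      setIntegral_one_div_exp_sub hz.le]
    simpa using (integral_Ioi_div_exp_sub hz.le).symm
  | succ r ih =>
    have h1 : ∀ w ∈ Ioo z 0, polyLi (r + 1) w / w =
        ∫ s in Ioi (0 : ℝ), s ^ r / r.factorial * (1 / (Real.exp s - w)) := fun w hw => by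
      have := hw.2.ne
      rw [ih hw.2, ← integral_div]
      congr 1 with s
      field_simp
    -- After Fubini the inner `w`-integral is a logarithm, and integration by parts trades it for
    -- one more power of `s`.
    rw [polyLi_succ_eq_neg_setIntegral hz.le, setIntegral_congr_fun measurableSet_Ioo h1,
      integral_integral_swap (integrable_pow_mul_one_div_exp_sub_prod z r),
      ← integral_Ioi_pow_mul_log hz.le r, ← integral_neg]
    congr 1 with s
    rw [integral_const_mul, setIntegral_one_div_exp_sub hz.le, mul_neg]

end

/-! ### Kaneko–Tsumura values as moments of the exponential kernel -/

/-- For `z = 1 - e^t` the integrand `z/(e^s - z)`, divided by `z`, is exactly the kernel. -/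
theorem polyLi_div_eq_integral_expKernel (r : ℕ) {t : ℝ} (ht : 0 < t) :
    polyLi (r + 1) (1 - Real.exp t) / (1 - Real.exp t) =
      ∫ s, s ^ r / r.factorial * expKernel (s, t) := by
  have hz : 1 - Real.exp t < 0 := by linarith [Real.one_lt_exp_iff.mpr ht]
  have h1 : (fun s => s ^ r / r.factorial * expKernel (s, t)) = (Ioi (0 : ℝ)).indicator
      fun s => s ^ r / r.factorial * ((1 - Real.exp t) / (Real.exp s - (1 - Real.exp t))) /
        (1 - Real.exp t) := by
    ext s
    rw [indicator_apply, expKernel]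
    simp only [mul_ite, mul_zero, mem_Ioi, ht, and_true]
    refine if_congr Iff.rfl ?_ rfl
    rw [mul_div_assoc, div_right_comm, div_self hz.ne]
    ring_nf
  rw [h1, integral_indicator measurableSet_Ioi, integral_div, polyLi_succ_eq_integral r hz]

theorem expKernel_of_snd_nonpos {t : ℝ} (ht : ¬ 0 < t) (s : ℝ) : expKernel (s, t) = 0 :=
  if_neg fun h => ht h.2

theorem integral_expKernel_slice_eq_indicator (r m : ℕ) :
    (fun t => ∫ s, s ^ r / r.factorial * (t ^ m / m.factorial) * expKernel (s, t)) =
      (Ioi (0 : ℝ)).indicator fun t => t ^ m / m.factorial *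
        (polyLi (r + 1) (1 - Real.exp t) / (1 - Real.exp t)) := by
  ext t
  by_cases ht : 0 < t
  · rw [indicator_of_mem (mem_Ioi.mpr ht), polyLi_div_eq_integral_expKernel r ht,
      ← integral_const_mul]
    congr 1 with s
    ring
  · rw [indicator_of_notMem (by simpa using ht)]
    simp [expKernel_of_snd_nonpos ht]

theorem integrableOn_pow_mul_polyLi_div (r m : ℕ) :
    IntegrableOn (fun t => t ^ m / m.factorial *
        (polyLi (r + 1) (1 - Real.exp t) / (1 - Real.exp t))) (Ioi 0) := by
  rw [← integrable_indicator_iff measurableSet_Ioi, ← integral_expKernel_slice_eq_indicator]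
  exact (isDiagKernel_expKernel.integrable_moment r m).integral_prod_right

theorem kernelMoment_expKernel (r m : ℕ) :
    kernelMoment expKernel r m = ∫ t in Ioi (0 : ℝ), t ^ m / m.factorial *
        (polyLi (r + 1) (1 - Real.exp t) / (1 - Real.exp t)) := by
  rw [kernelMoment, Measure.volume_eq_prod,
    integral_prod_symm _ (isDiagKernel_expKernel.integrable_moment r m),
    ← integral_indicator measurableSet_Ioi, ← integral_expKernel_slice_eq_indicator]

theorem etaIntegrand_natCast_add_one (k m : ℕ) (t : ℝ) :
    etaIntegrand k ((m : ℂ) + 1) t = (m.factorial : ℂ) *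
      ((t ^ m / m.factorial * (polyLi k (1 - Real.exp t) / (1 - Real.exp t)) : ℝ) : ℂ) := by
  have : (m.factorial : ℂ) ≠ 0 := Nat.cast_ne_zero.mpr m.factorial_ne_zero
  rw [etaIntegrand, add_sub_cancel_right, Complex.cpow_natCast]
  push_cast
  field_simp

theorem integrableOn_etaIntegrand (r m : ℕ) :
    IntegrableOn (etaIntegrand (r + 1) ((m : ℂ) + 1)) (Ioi (0 : ℝ)) := by
  rw [funext (etaIntegrand_natCast_add_one (r + 1) m)]
  exact (integrableOn_pow_mul_polyLi_div r m).integrable.ofReal.const_mul _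

theorem kanekoTsumuraEta_eq_kernelMoment (r m : ℕ) :
    kanekoTsumuraEta (r + 1) ((m : ℂ) + 1) = (kernelMoment expKernel r m : ℂ) := by
  have : (m.factorial : ℂ) ≠ 0 := Nat.cast_ne_zero.mpr m.factorial_ne_zero
  rw [kanekoTsumuraEta, funext (etaIntegrand_natCast_add_one (r + 1) m), integral_const_mul,
    integral_complex_ofReal, ← kernelMoment_expKernel, Complex.Gamma_nat_eq_factorial]
  field_simp

/-! ### The alternating sum formula -/

theorem sum_multiZeta_onesThen (k : ℕ) :
    ∑ p ∈ Finset.HasAntidiagonal.antidiagonal k,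
        (-1 : ℝ) ^ p.1 * multiZeta (onesThen p.1 (p.2 + 2)) =
      (1 + (-1) ^ k) * ((1 - 1 / 2 ^ (k + 1)) * multiZeta (onesThen 0 (k + 2))) := by
  rw [← integral_pow_mul_log_one_add_exp_neg, ← isDiagKernel_regionKernel.sum_kernelMoment_eq k]
  -- The sign sits on the number of ones `a`, which is the second index of the moment, so the pairs
  -- are swapped.
  refine Finset.sum_equiv (Equiv.prodComm ℕ ℕ) (fun p => ?_) fun p _ => ?_
  · simp [Finset.HasAntidiagonal.mem_antidiagonal, add_comm]
  · simp [multiZeta_onesThen_eq]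

theorem corollary4p7 (k : ℕ) :
    -- all the integrals and series involved converge absolutely
    (∀ r m : ℕ, r + m = k →
      MeasureTheory.IntegrableOn (etaIntegrand (r + 1) ((m : ℂ) + 1)) (Set.Ioi (0 : ℝ))) ∧
    (∀ a b : ℕ, a + b = k → Summable (mzvTerm (onesThen a (b + 2)))) ∧
    -- the alternating sum formula
    ∑ p ∈ Finset.HasAntidiagonal.antidiagonal k,
        (-1 : ℂ) ^ p.2 * kanekoTsumuraEta (p.1 + 1) ((p.2 : ℂ) + 1) =
      ∑ p ∈ Finset.HasAntidiagonal.antidiagonal k, (-1 : ℂ) ^ p.1 * (multiZeta (onesThen p.1 (p.2 + 2)) : ℂ) ∧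
    -- its evaluation for even and for odd `k`
    (∀ c : ℕ, k = 2 * c →
      ∑ p ∈ Finset.HasAntidiagonal.antidiagonal k, (-1 : ℂ) ^ p.1 * (multiZeta (onesThen p.1 (p.2 + 2)) : ℂ) =
        2 * (1 - 1 / 2 ^ (2 * c + 1)) * riemannZeta (2 * (c : ℂ) + 2)) ∧
    (∀ c : ℕ, k = 2 * c + 1 →
      ∑ p ∈ Finset.HasAntidiagonal.antidiagonal k, (-1 : ℂ) ^ p.1 * (multiZeta (onesThen p.1 (p.2 + 2)) : ℂ) =
        0) := by
  have hz : ∑ p ∈ Finset.HasAntidiagonal.antidiagonal k,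
      (-1 : ℂ) ^ p.1 * (multiZeta (onesThen p.1 (p.2 + 2)) : ℂ) =
      (1 + (-1) ^ k) * ((1 - 1 / 2 ^ (k + 1)) * riemannZeta (k + 2)) := by
    have h := congrArg Complex.ofReal (sum_multiZeta_onesThen k)
    push_cast at h
    rw [h, multiZeta_onesThen_zero]
  refine ⟨fun r m _ => integrableOn_etaIntegrand r m,
    fun a b _ => (hasSum_mzvTerm_onesThen a b).summable, ?_, fun c hc => ?_, fun c hc => ?_⟩
  -- Both alternating sums equal the same kernel-independent integral.
  · have h := congrArg Complex.ofReal ((isDiagKernel_expKernel.sum_kernelMoment_eq k).trans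
      ((congrArg _ (integral_pow_mul_log_one_add_exp_neg k)).trans (sum_multiZeta_onesThen k).symm))
    push_cast at h
    simpa only [kanekoTsumuraEta_eq_kernelMoment] using h
  · rw [hz, hc, pow_mul]
    push_cast
    norm_num
    ring
  · rw [hz, hc, pow_succ, pow_mul]
    norm_num
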